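/- For a set $A$ let $[A]^2$ be the set of two-element subsets of $A$. For a pair-coloring $c:[A]^2\to 2=\{0,1\}$, a set $H\subseteq A$ is $c$-homogeneous if $c$ is constant on $[H]^2$, and the homogeneity number $\mathfrak{hm}(c)$ is the least cardinality of a family of $c$-homogeneous subsets of $A$ that covers $A$. If $X$ is a topological space, $[X]^2$ carries the quotient topology from $X^2\setminus\{(x,x):x\in X\}$, and $c:[X]^2\to 2$ is continuous if the preimages of $0$ and $1$ are open. For distinct sequences $x,y$ let $\Delta(x,y)=\min\{n:x(n)\ne y(n)\}$. Let $c_{\min}$ be the pair-coloring of $2^\omega$ in which $c_{\min}(x,y)$ is the parity of $\Delta(x,y)$. Let $\chi_{\mathrm{random}}:[\omega]^2\to 2$ be the characteristic function of the edge relation of (any fixed copy on $\omega$ of) the random graph, i.e. the graph on $\omega$ that is homogeneous (every isomorphism between finite induced subgraphs extends to an automorphism) and universal (every graph on $\omega$ embeds into it as an induced subgraph). Let $c_{\max}$ be the pair-coloring of the compact space $\prod_{n\in\omega}\{0,\dots,n\}$ (which is homeomorphic to $2^\omega$) given by $c_{\max}(x,y)=\chi_{\mathrm{random}}(x(n),y(n))$,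 where $n=\Delta(x,y)$. Let $\mathfrak d$ be the least cardinality of a family of functions $\omega\to\omega$ such that every function $\omega\to\omega$ is eventually dominated by a member of the family. **Theorem.** For every Polish space $X$ and every continuous pair-coloring $c:[X]^2\to 2$ with $\mathfrak{hm}(c)>\aleph_0$, $$\mathfrak{hm}(c_{\min})\le \mathfrak{hm}(c)\le \mathfrak{hm}(c_{\max}),$$ and $$\mathfrak{hm}(c)=\mathfrak{hm}(c_{\min})\quad\text{or}\quad \mathfrak{hm}(c)=\mathfrak{hm}(c_{\max}).$$ Moreover, $\mathfrak{hm}(c_{\min})^+\ge 2^{\aleph_0}$ and $\mathfrak{hm}(c_{\min})\ge\mathfrak d$. -/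

import Mathlib

universe u

/-- `[X]²`: the set of two-element subsets of `X`, as non-diagonal unordered pairs. -/
abbrev Pairs (X : Type u) : Type u := {p : Sym2 X // ¬ p.IsDiag}

/-- The unordered pair `{x, y}` of two distinct points. -/
def Pairs.mk {X : Type u} (x y : X) (h : x ≠ y) : Pairs X :=
  ⟨s(x, y), fun hd => h (Sym2.mk_isDiag_iff.mp hd)⟩

/-- A pair-coloring `c : [X]² → 2`. -/
abbrev PairColoring (X : Type u) : Type u := Pairs X → Fin 2

namespace PairColoring

/-- The pair-coloring induced by a symmetric function (its diagonal values are discarded). -/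
def ofSymm {X : Type u} (f : X → X → Fin 2) (hf : ∀ x y, f x y = f y x) : PairColoring X :=
  fun p => Sym2.lift ⟨f, hf⟩ p.1

/-- Continuity with respect to the quotient topology that `[X]²` inherits from
`X × X` minus the diagonal: the corresponding symmetric function is continuous there. -/
def IsContinuous {X : Type u} [TopologicalSpace X] (c : PairColoring X) : Prop :=
  Continuous fun p : {p : X × X // p.1 ≠ p.2} => c (Pairs.mk p.1.1 p.1.2 p.2)

/-- `H` is `c`-homogeneous: `c` is constant on `[H]²`. -/
def IsHomogeneous {X : Type u} (c : PairColoring X) (H : Set X) : Prop :=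
  ∃ i : Fin 2, ∀ x ∈ H, ∀ y ∈ H, ∀ h : x ≠ y, c (Pairs.mk x y h) = i

/-- The homogeneity number of `c`: the least cardinality of a family of `c`-homogeneous sets
that covers the space. -/
noncomputable def hm {X : Type u} (c : PairColoring X) : Cardinal.{u} :=
  sInf {κ : Cardinal.{u} | ∃ F : Set (Set X),
    (∀ H ∈ F, c.IsHomogeneous H) ∧ ⋃₀ F = Set.univ ∧ Cardinal.mk F = κ}

/-- `c_min`, on the Cantor space: the color of `{x, y}` is the parity of the first coordinate
at which `x` and `y` differ. -/
noncomputable def cMin : PairColoring (ℕ → Fin 2) :=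
  ofSymm (fun x y => ⟨PiNat.firstDiff x y % 2, Nat.mod_lt _ Nat.two_pos⟩)
    (fun x y => by simp only [PiNat.firstDiff_comm x y])

open Classical in
/-- `c_max`, on the compact space `∏ n, {0, …, n}`, relative to a graph `R` on `ℕ` (a copy of the
random graph): with `n` the first coordinate at which `x` and `y` differ, the color of `{x, y}`
is `1` if `x n` and `y n` are joined by an edge of `R`, and `0` otherwise. -/
noncomputable def cMax (R : SimpleGraph ℕ) : PairColoring ((n : ℕ) → Fin (n + 1)) :=
  ofSymm
    (fun x y =>
      if R.Adj (x (PiNat.firstDiff x y)).val (y (PiNat.firstDiff x y)).val then 1 else 0)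
    (fun x y => by rw [PiNat.firstDiff_comm x y]; simp only [R.adj_comm])

end PairColoring

/-- `R` is (a copy on `ℕ` of) the random graph: the homogeneous and universal graph on `ℕ`. -/
structure IsRandomGraph (R : SimpleGraph ℕ) : Prop where
  /-- Every isomorphism between finite induced subgraphs extends to an automorphism. -/
  homogeneous : ∀ (A : Finset ℕ) (f : R.induce (A : Set ℕ) ↪g R),
    ∃ φ : R ≃g R, ∀ a : (A : Set ℕ), φ a.val = f a
  /-- Every graph on `ℕ` embeds into `R` as an induced subgraph. -/
  universal : ∀ G : SimpleGraph ℕ, Nonempty (G ↪g R)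

/-- The domination number `𝔡`: the least cardinality of a family of functions `ℕ → ℕ` such that
every function `ℕ → ℕ` is eventually dominated by a member of the family. -/
noncomputable def dominationNumber : Cardinal.{0} :=
  sInf {κ : Cardinal.{0} | ∃ D : Set (ℕ → ℕ),
    (∀ g : ℕ → ℕ, ∃ f ∈ D, ∀ᶠ n in Filter.atTop, g n ≤ f n) ∧ Cardinal.mk D = κ}

open Cardinal hiding univ
open Set Filter Topology

/-! The dichotomy follows from the inequality `2 ^ ℵ₀ ≤ Order.succ cMin.hm`: once `hm c` exceeds
`cMin.hm`, it is at least the continuum, which bounds `hm` of `c_max`. For the lower bound on `hm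
c`, removing the open sets coverable by countably many homogeneous sets leaves a kernel in which no
nonempty relatively open piece is homogeneous. Both colors thus occur everywhere, and a Cantor
scheme copies `c_min` into `c`. For the upper bound, `𝔡` many compact sets cover a Polish space, and
`𝔡 ≤ cMin.hm`. On each compact set a second covering, of size `cMin.hm`, gives pieces on which the
color of a pair can be read off at the first difference of suitable codes; universality of the
random graph then embeds each piece into `c_max`. The bounds on `cMin.hm` come from covering Baire
space, split into even and odd coordinates, by sets whose first differences all have one parity. -/

theorem firstDiff_eq_of_forall_lt {E : ℕ → Type*} {x y : ∀ n, E n} {n : ℕ}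
    (h : ∀ j < n, x j = y j) (hn : x n ≠ y n) : PiNat.firstDiff x y = n := by
  have hne : x ≠ y := fun hxy => hn (congrFun hxy n)
  refine le_antisymm ?_ ?_
  · by_contra! hlt
    exact hn (PiNat.apply_eq_of_lt_firstDiff hlt)
  · by_contra! hlt
    exact PiNat.apply_firstDiff_ne hne (h _ hlt)

/-! ### Homogeneous coverings and embeddings of colorings -/

namespace PairColoring

theorem cMin_mk {x y : ℕ → Fin 2} (h : x ≠ y) :
    (cMin (Pairs.mk x y h)).val = PiNat.firstDiff x y % 2 := rfl

theorem hm_spec {X : Type u} (c : PairColoring X) : ∃ F : Set (Set X),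
    (∀ H ∈ F, c.IsHomogeneous H) ∧ ⋃₀ F = univ ∧ #F = c.hm := by
  refine csInf_mem (s := {κ : Cardinal.{u} | ∃ F : Set (Set X),
    (∀ H ∈ F, c.IsHomogeneous H) ∧ ⋃₀ F = univ ∧ #F = κ})
    ⟨_, range (fun x : X => {x}), ?_, ?_, rfl⟩
  · rintro _ ⟨x, rfl⟩
    refine ⟨0, ?_⟩
    rintro a rfl b rfl h
    exact absurd rfl h
  · ext x
    simp

theorem hm_le {X : Type u} {c : PairColoring X} {F : Set (Set X)}
    (hF : ∀ H ∈ F, c.IsHomogeneous H) (hU : ⋃₀ F = univ) : c.hm ≤ #F :=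
  csInf_le' ⟨F, hF, hU, rfl⟩

/-- `S` can be covered by at most `κ` many `c`-homogeneous sets. -/
def CoveredBy {X : Type u} (c : PairColoring X) (S : Set X) (κ : Cardinal.{0}) : Prop :=
  ∃ (ι : Type) (H : ι → Set X), #ι ≤ κ ∧ (∀ i, c.IsHomogeneous (H i)) ∧ S ⊆ ⋃ i, H i

theorem coveredBy_univ_hm {X : Type} (c : PairColoring X) : c.CoveredBy univ c.hm := by
  obtain ⟨F, hF, hU, hc⟩ := c.hm_spec
  refine ⟨F, fun i => i.1, hc.le, fun i => hF _ i.2, ?_⟩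
  rw [← sUnion_eq_iUnion, hU]

theorem CoveredBy.hm_le {X : Type u} {c : PairColoring X} {κ : Cardinal.{0}}
    (h : c.CoveredBy univ κ) : c.hm ≤ lift.{u} κ := by
  obtain ⟨ι, H, hι, hH, hU⟩ := h
  refine (PairColoring.hm_le (F := range H) ?_ ?_).trans ?_
  · rintro _ ⟨i, rfl⟩
    exact hH i
  · rw [sUnion_range]
    exact univ_subset_iff.1 hU
  · have := mk_range_le_lift (f := H)
    rw [lift_uzero] at this
    exact this.trans (lift_le.2 hι)

theorem CoveredBy.iUnion {X : Type u} {c : PairColoring X} {κ : Cardinal.{0}} (hκ : ℵ₀ ≤ κ)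
    {ι : Type} (hι : #ι ≤ κ) {S : ι → Set X} (h : ∀ i, c.CoveredBy (S i) κ) :
    c.CoveredBy (⋃ i, S i) κ := by
  choose J H hJ hH hS using h
  refine ⟨Σ i, J i, fun p => H p.1 p.2, ?_, fun p => hH p.1 p.2, ?_⟩
  · rw [mk_sigma]
    refine (sum_le_mk_mul_iSup _).trans ?_
    exact mul_le_of_le hκ hι (ciSup_le' hJ)
  · refine iUnion_subset fun i x hx => ?_
    obtain ⟨j, hj⟩ := mem_iUnion.1 (hS i hx)
    exact mem_iUnion.2 ⟨⟨i, j⟩, hj⟩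

theorem CoveredBy.mono {X : Type u} {c : PairColoring X} {κ : Cardinal.{0}} {S T : Set X}
    (h : c.CoveredBy T κ) (hST : S ⊆ T) : c.CoveredBy S κ := by
  obtain ⟨ι, H, hι, hH, hU⟩ := h
  exact ⟨ι, H, hι, hH, hST.trans hU⟩

/-- `e` is injective on `S` and carries the coloring `c` on `S` to the coloring `d`. -/
def Embeds {X : Type*} {Y : Type*} (c : PairColoring X) (d : PairColoring Y) (S : Set X)
    (e : X → Y) : Prop :=
  ∀ x ∈ S, ∀ y ∈ S, ∀ h : x ≠ y, ∃ h' : e x ≠ e y,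
    d (Pairs.mk (e x) (e y) h') = c (Pairs.mk x y h)

theorem Embeds.isHomogeneous {X : Type*} {Y : Type*} {c : PairColoring X}
    {d : PairColoring Y} {S : Set X} {e : X → Y} (he : c.Embeds d S e) {H : Set Y}
    (hH : d.IsHomogeneous H) : c.IsHomogeneous (S ∩ e ⁻¹' H) := by
  obtain ⟨i, hi⟩ := hH
  refine ⟨i, fun x hx y hy h => ?_⟩
  obtain ⟨h', hc⟩ := he x hx.1 y hy.1 h
  rw [← hc]
  exact hi _ hx.2 _ hy.2 h'

theorem Embeds.coveredBy {X : Type*} {Y : Type*} {c : PairColoring X}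
    {d : PairColoring Y} {S : Set X} {e : X → Y} (he : c.Embeds d S e) {κ : Cardinal.{0}}
    (hd : d.CoveredBy univ κ) : c.CoveredBy S κ := by
  obtain ⟨ι, H, hι, hH, hU⟩ := hd
  refine ⟨ι, fun i => S ∩ e ⁻¹' H i, hι, fun i => he.isHomogeneous (hH i), fun x hx => ?_⟩
  obtain ⟨i, hi⟩ := mem_iUnion.1 (hU (mem_univ (e x)))
  exact mem_iUnion.2 ⟨i, hx, hi⟩

theorem Embeds.lift_hm_le {X : Type} {Y : Type u} {c : PairColoring X}
    {d : PairColoring Y} {e : X → Y} (he : c.Embeds d univ e) : lift.{u} c.hm ≤ d.hm := by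
  obtain ⟨F, hF, hU, hc⟩ := d.hm_spec
  have h1 : c.hm ≤ #(range fun H : F => e ⁻¹' H.1) := by
    refine PairColoring.hm_le ?_ ?_
    · rintro _ ⟨H, rfl⟩
      simpa using he.isHomogeneous (hF _ H.2)
    · refine univ_subset_iff.1 fun x _ => ?_
      obtain ⟨H, hH, hx⟩ := mem_sUnion.1 (hU.symm ▸ mem_univ (e x) : e x ∈ ⋃₀ F)
      exact ⟨_, ⟨⟨H, hH⟩, rfl⟩, hx⟩
  rw [← hc]
  refine (lift_le.2 h1).trans ?_
  have := mk_range_le_lift (f := fun H : F => e ⁻¹' H.1)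
  rwa [lift_uzero] at this

/-! ### Parity on Baire space and the lower bounds for `cMin.hm` -/

/-- The position of the `j`-th one in the code of `x`. -/
def onePos (x : ℕ → ℕ) (j : ℕ) : ℕ := j + 2 * ∑ l ∈ Finset.range (j + 1), x l

theorem onePos_strictMono (x : ℕ → ℕ) : StrictMono (onePos x) := by
  refine strictMono_nat_of_lt_succ fun j => ?_
  simp only [onePos, Finset.sum_range_succ _ (j + 1)]
  omega

open Classical in
/-- The code of a sequence of numbers, in which the parity of the first difference is kept. -/
noncomputable def parityCode (x : ℕ → ℕ) : ℕ → Fin 2 :=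
  fun q => if ∃ j, onePos x j = q then 1 else 0

/-- The ones numbered below `i` coincide in both codes. The `i`-th one comes earlier for `x`, at a
position congruent to `i` mod 2 since the sum is doubled, and there the code of `y` still has a
zero. -/
theorem firstDiff_parityCode_aux {x y : ℕ → ℕ} {i : ℕ} (h : ∀ j < i, x j = y j)
    (hi : x i < y i) : parityCode x ≠ parityCode y ∧
      PiNat.firstDiff (parityCode x) (parityCode y) % 2 = i % 2 := by
  have hp : ∀ j < i, onePos x j = onePos y j := by
    intro j hj
    simp only [onePos]
    rw [Finset.sum_congr rfl fun l hl => h l (by simp at hl; omega)]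
  have hlt : onePos x i < onePos y i := by
    have hs : ∑ l ∈ Finset.range i, x l = ∑ l ∈ Finset.range i, y l :=
      Finset.sum_congr rfl fun l hl => h l (by simpa using hl)
    simp only [onePos, Finset.sum_range_succ]
    omega
  have hne : parityCode x (onePos x i) ≠ parityCode y (onePos x i) := by
    have hy : ¬ ∃ j, onePos y j = onePos x i := by
      rintro ⟨j, hj⟩
      rcases lt_or_ge j i with hji | hji
      · rw [← hp j hji] at hj
        exact hji.ne ((onePos_strictMono x).injective hj)
      · have := (onePos_strictMono y).monotone hji
        omega
    simp [parityCode, hy]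
  refine ⟨fun h => hne (congrFun h _), ?_⟩
  rw [firstDiff_eq_of_forall_lt (n := onePos x i) _ hne]
  · simp only [onePos]
    omega
  · intro r hr
    have : (∃ j, onePos x j = r) ↔ ∃ j, onePos y j = r := by
      constructor
      · rintro ⟨j, rfl⟩
        exact ⟨j, (hp j ((onePos_strictMono x).lt_iff_lt.1 hr)).symm⟩
      · rintro ⟨j, rfl⟩
        exact ⟨j, hp j ((onePos_strictMono y).lt_iff_lt.1 (hr.trans hlt))⟩
    classical exact if_congr this rfl rfl

theorem firstDiff_parityCode {x y : ℕ → ℕ} (h : x ≠ y) : parityCode x ≠ parityCode y ∧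
    PiNat.firstDiff (parityCode x) (parityCode y) % 2 = PiNat.firstDiff x y % 2 := by
  rcases lt_or_gt_of_ne (PiNat.apply_firstDiff_ne h) with hlt | hlt
  · exact firstDiff_parityCode_aux (fun j hj => PiNat.apply_eq_of_lt_firstDiff hj) hlt
  · have := firstDiff_parityCode_aux (fun j hj => (PiNat.apply_eq_of_lt_firstDiff hj).symm) hlt
    rw [PiNat.firstDiff_comm (parityCode y)] at this
    exact ⟨this.1.symm, this.2⟩

/-- All first differences of elements of `H` have parity `i`. -/
def HasParity (H : Set (ℕ → ℕ)) (i : Fin 2) : Prop :=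
  ∀ x ∈ H, ∀ y ∈ H, x ≠ y → PiNat.firstDiff x y % 2 = i.val

theorem exists_parity_cover : ∃ (ι : Type) (H : ι → Set (ℕ → ℕ)) (i : ι → Fin 2),
    #ι ≤ cMin.hm ∧ (∀ a, HasParity (H a) (i a)) ∧ ∀ x, ∃ a, x ∈ H a := by
  obtain ⟨ι, H, hι, hH, hU⟩ := cMin.coveredBy_univ_hm
  choose i hi using hH
  refine ⟨ι, fun a => parityCode ⁻¹' H a, i, hι, fun a x hx y hy hxy => ?_, fun x => ?_⟩
  · obtain ⟨hne, hpar⟩ := firstDiff_parityCode hxy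
    rw [← hpar, ← cMin_mk hne, hi a _ hx _ hy hne]
  · obtain ⟨a, ha⟩ := mem_iUnion.1 (hU (mem_univ (parityCode x)))
    exact ⟨a, ha⟩

/-- The sequence with `e` at the even and `o` at the odd coordinates. -/
def interleave (e o : ℕ → ℕ) (n : ℕ) : ℕ := if n % 2 = 0 then e (n / 2) else o (n / 2)

theorem interleave_even (e o : ℕ → ℕ) (n : ℕ) : interleave e o (2 * n) = e n := by
  simp [interleave]

theorem interleave_odd (e o : ℕ → ℕ) (n : ℕ) : interleave e o (2 * n + 1) = o n := by
  have : (2 * n + 1) / 2 = n := by omega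
  simp [interleave, this]

/-- A difference at the odd coordinate `2 * n + 1` must be preceded by one at an even coordinate, so
an even-parity set acts as the graph of a Lipschitz partial function sending `e` to `o`. -/
theorem HasParity.odd_eq {H : Set (ℕ → ℕ)} (hH : HasParity H 0) {e o e' o' : ℕ → ℕ}
    (h : interleave e o ∈ H) (h' : interleave e' o' ∈ H) {n : ℕ} (he : ∀ j ≤ n, e j = e' j) :
    o n = o' n := by
  by_contra hne
  have hne' : interleave e o ≠ interleave e' o' := fun h => hne <| by
    rw [← interleave_odd e o, h, interleave_odd]
  have hp : PiNat.firstDiff (interleave e o) (interleave e' o') % 2 = 0 := hH _ h _ h' hne'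
  obtain ⟨j, hj⟩ : ∃ j, PiNat.firstDiff (interleave e o) (interleave e' o') = 2 * j :=
    ⟨_, (Nat.mul_div_cancel' (Nat.dvd_of_mod_eq_zero hp)).symm⟩
  have h1 := PiNat.apply_firstDiff_ne hne'
  rw [hj, interleave_even, interleave_even] at h1
  refine h1 (he j ?_)
  by_contra! hlt
  have := PiNat.apply_eq_of_lt_firstDiff (x := interleave e o) (y := interleave e' o')
    (n := 2 * n + 1) (by omega)
  rw [interleave_odd, interleave_odd] at this
  exact hne this

theorem HasParity.even_eq {H : Set (ℕ → ℕ)} (hH : HasParity H 1) {e o e' : ℕ → ℕ}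
    (h : interleave e o ∈ H) (h' : interleave e' o ∈ H) : e = e' := by
  by_contra hne
  have hne' : interleave e o ≠ interleave e' o := fun h => hne <| funext fun n => by
    rw [← interleave_even e o, h, interleave_even]
  have hp : PiNat.firstDiff (interleave e o) (interleave e' o) % 2 = 1 := hH _ h _ h' hne'
  have h1 := PiNat.apply_firstDiff_ne hne'
  have hj : PiNat.firstDiff (interleave e o) (interleave e' o) =
    2 * (PiNat.firstDiff (interleave e o) (interleave e' o) / 2) + 1 := by omega
  rw [hj, interleave_odd, interleave_odd] at h1
  exact h1 rfl

/-- Fix more than `cMin.hm`, but fewer than continuum many, even parts `e`. Each even-parity set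
allows at most one `o` per `e`, so some `o` is never met in this way. All its pairs with the chosen
`e` then lie in odd-parity sets, each of which contains at most one of them. -/
theorem continuum_le_succ_hm_cMin : 2 ^ ℵ₀ ≤ Order.succ cMin.hm := by
  by_contra! hlt
  obtain ⟨ι, H, i, hι, hH, hU⟩ := exists_parity_cover
  have hcard : #(ℕ → ℕ) = 2 ^ ℵ₀ := by simp
  obtain ⟨A, hA⟩ := le_mk_iff_exists_set.1 (hcard ▸ hlt.le : Order.succ cMin.hm ≤ #(ℕ → ℕ))
  have hbad : ∃ o : ℕ → ℕ, ∀ a : A, ∀ j : ι, interleave a.1 o ∈ H j → i j ≠ 0 := by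
    by_contra! hcon
    choose a j hm hj using hcon
    have hinj : Function.Injective fun o => (a o, j o) := by
      intro o o' hoo
      simp only [Prod.mk.injEq] at hoo
      funext n
      have h0 : HasParity (H (j o)) 0 := hj o ▸ hH (j o)
      refine h0.odd_eq (hm o) (hoo.2 ▸ hm o') fun k _ => by rw [hoo.1]
    have := mk_le_of_injective hinj
    rw [hcard, mk_prod, lift_id, lift_id, hA] at this
    refine this.not_gt (mul_lt_of_lt (cantor _).le hlt ?_)
    exact hι.trans_lt ((Order.le_succ _).trans_lt hlt)
  obtain ⟨o, ho⟩ := hbad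
  choose j hj using fun a : A => hU (interleave a.1 o)
  have hinj : Function.Injective j := by
    intro a b hab
    have h1 : HasParity (H (j a)) 1 := by
      have h0 := ho a (j a) (hj a)
      have : i (j a) = 1 := by omega
      exact this ▸ hH (j a)
    exact Subtype.ext (h1.even_eq (hj a) (hab ▸ hj b))
  have := mk_le_of_injective hinj
  rw [hA] at this
  exact (this.trans hι).not_gt (Order.lt_succ_of_not_isMax (not_isMax _))

theorem aleph0_le_hm_cMin : ℵ₀ ≤ cMin.hm := by
  by_contra! hlt
  have h1 : Order.succ cMin.hm ≤ ℵ₀ := Order.succ_le_of_lt hlt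
  exact ((cantor ℵ₀).trans_le continuum_le_succ_hm_cMin).not_ge h1

/-- With binary even parts, each even-parity set bounds its odd parts by a single function. A `g`
dominated by none of these bounds would send all continuum many points `interleave e g` into
distinct odd-parity sets. -/
theorem dominationNumber_le_hm_cMin : dominationNumber ≤ cMin.hm := by
  rcases le_or_gt (2 ^ ℵ₀) cMin.hm with hle | hlt
  · refine le_trans (csInf_le' ⟨univ, fun g => ⟨g, mem_univ _, by simp⟩, rfl⟩) ?_
    simpa using hle
  obtain ⟨ι, H, i, hι, hH, hU⟩ := exists_parity_cover
  have hb : ∀ a, ∃ f : ℕ → ℕ, i a = 0 → ∀ (e : ℕ → Fin 2) (o : ℕ → ℕ),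
      interleave (fun n => (e n).val) o ∈ H a → ∀ n, o n ≤ f n := by
    intro a
    by_cases ha : i a = 0
    · have h0 : HasParity (H a) 0 := ha ▸ hH a
      have : ∀ n, ∃ b : ℕ, ∀ (e : ℕ → Fin 2) (o : ℕ → ℕ),
          interleave (fun n => (e n).val) o ∈ H a → o n ≤ b := by
        intro n
        -- The value `o n` depends only on the first `n + 1` entries of `e`, which leaves finitely
        -- many cases; 0 serves for prefixes that do not occur.
        have hs : ∀ s : Fin (n + 1) → Fin 2, ∃ b : ℕ, ∀ (e : ℕ → Fin 2) (o : ℕ → ℕ),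
            interleave (fun n => (e n).val) o ∈ H a → (∀ k : Fin (n + 1), e k = s k) →
              o n = b := by
          intro s
          by_cases hex : ∃ (e : ℕ → Fin 2) (o : ℕ → ℕ),
            interleave (fun n => (e n).val) o ∈ H a ∧ ∀ k : Fin (n + 1), e k = s k
          · obtain ⟨e, o, h, hk⟩ := hex
            refine ⟨o n, fun e' o' h' hk' => h0.odd_eq h' h fun j hj => ?_⟩
            have := (hk' ⟨j, by omega⟩).trans (hk ⟨j, by omega⟩).symm
            exact congrArg Fin.val this
          · exact ⟨0, fun e o h hk => absurd ⟨e, o, h, hk⟩ hex⟩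
        choose b hb using hs
        refine ⟨Finset.univ.sup b, fun e o h => ?_⟩
        rw [hb (fun k => e k) e o h fun _ => rfl]
        exact Finset.le_sup (Finset.mem_univ _)
      choose f hf using this
      exact ⟨f, fun _ e o h n => hf n e o h⟩
    · exact ⟨0, fun h => absurd h ha⟩
  choose f hf using hb
  refine le_trans (csInf_le' ⟨range f, fun g => ?_, rfl⟩) (mk_range_le.trans hι)
  by_contra hcon
  choose j hj using fun e : ℕ → Fin 2 => hU (interleave (fun n => (e n).val) g)
  have hinj : Function.Injective j := by
    intro e e' hee
    have h1 : HasParity (H (j e)) 1 := by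
      have h0 : i (j e) ≠ 0 := fun h0 => by
        refine hcon ⟨f (j e), ⟨_, rfl⟩, ?_⟩
        exact Filter.Eventually.of_forall (hf _ h0 e g (hj e))
      have : i (j e) = 1 := by omega
      exact this ▸ hH (j e)
    have := h1.even_eq (hj e) (hee ▸ hj e')
    exact funext fun n => Fin.ext (congrFun this n)
  have h2 := mk_le_of_injective hinj
  have h3 : #(ℕ → Fin 2) = 2 ^ ℵ₀ := by simp
  rw [h3] at h2
  exact (h2.trans hι).not_gt hlt

end PairColoring

/-! ### Kernels of continuous colorings and a copy of `c_min` -/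

theorem Pairs.mk_comm {X : Type u} {x y : X} (h : x ≠ y) :
    Pairs.mk x y h = Pairs.mk y x h.symm :=
  Subtype.ext Sym2.eq_swap

theorem exists_nat_isTopologicalBasis (X : Type u) [TopologicalSpace X]
    [SecondCountableTopology X] :
    ∃ B : ℕ → Set X, TopologicalSpace.IsTopologicalBasis (range B) := by
  have hb := TopologicalSpace.isBasis_countableBasis X
  -- The empty set keeps the family nonempty even for empty `X`, so that a sequence can enumerate
  -- it.
  have hb' := hb.insert_empty
  obtain ⟨B, hB⟩ := ((TopologicalSpace.countable_countableBasis X).insert ∅).exists_eq_range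
    (insert_nonempty _ _)
  exact ⟨B, hB ▸ hb'⟩

namespace PairColoring

theorem isOpen_setOf_color {X : Type u} [TopologicalSpace X] [T2Space X] {c : PairColoring X}
    (hc : c.IsContinuous) (i : Fin 2) :
    IsOpen {p : X × X | ∃ h : p.1 ≠ p.2, c (Pairs.mk p.1 p.2 h) = i} := by
  have hd : IsOpen {p : X × X | p.1 ≠ p.2} := isOpen_ne_fun continuous_fst continuous_snd
  convert hd.isOpenMap_subtype_val _ ((isOpen_discrete {i}).preimage hc)
  ext p
  simp

theorem IsContinuous.exists_isOpen {X : Type u} [TopologicalSpace X] [T2Space X]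
    {c : PairColoring X} (hc : c.IsContinuous) {x y : X} (h : x ≠ y) :
    ∃ N N' : Set X, IsOpen N ∧ IsOpen N' ∧ x ∈ N ∧ y ∈ N' ∧ ∀ a ∈ N, ∀ b ∈ N',
      ∃ h' : a ≠ b, c (Pairs.mk a b h') = c (Pairs.mk x y h) := by
  obtain ⟨N, N', hN, hN', hx, hy, hs⟩ :=
    isOpen_prod_iff.1 (isOpen_setOf_color hc (c (Pairs.mk x y h))) x y ⟨h, rfl⟩
  exact ⟨N, N', hN, hN', hx, hy, fun a ha b hb => hs (mk_mem_prod ha hb)⟩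

theorem IsHomogeneous.coveredBy {X : Type u} {c : PairColoring X} {H : Set X}
    (h : c.IsHomogeneous H) {κ : Cardinal.{0}} (hκ : 1 ≤ κ) : c.CoveredBy H κ :=
  ⟨Unit, fun _ => H, by simpa using hκ, fun _ => h, fun _ hx => mem_iUnion.2 ⟨(), hx⟩⟩

theorem CoveredBy.union {X : Type u} {c : PairColoring X} {κ : Cardinal.{0}} (hκ : ℵ₀ ≤ κ)
    {S T : Set X} (hS : c.CoveredBy S κ) (hT : c.CoveredBy T κ) : c.CoveredBy (S ∪ T) κ := by
  rw [union_eq_iUnion]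
  exact CoveredBy.iUnion hκ (mk_le_aleph0.trans hκ) (Bool.rec hT hS)

/-- A Cantor–Bendixson argument: a homogeneous relatively open piece of the complement of `O` would
make some basic set around one of its points countably coverable, hence part of `O`. -/
theorem exists_kernel {X : Type u} [TopologicalSpace X] [SecondCountableTopology X]
    {c : PairColoring X} (h : ℵ₀ < c.hm) : ∃ Y : Set X, Y.Nonempty ∧
      ∀ V, IsOpen V → (V ∩ Y).Nonempty → ¬ c.IsHomogeneous (V ∩ Y) := by
  obtain ⟨B, hB⟩ := exists_nat_isTopologicalBasis X
  set O : Set X := ⋃ n : {n // c.CoveredBy (B n) ℵ₀}, B n with hO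
  have hOc : c.CoveredBy O ℵ₀ := CoveredBy.iUnion le_rfl mk_le_aleph0 fun n => n.2
  refine ⟨Oᶜ, ?_, ?_⟩
  · rw [nonempty_compl]
    intro hu
    rw [hu] at hOc
    have hle := hOc.hm_le
    rw [lift_aleph0] at hle
    exact hle.not_gt h
  · rintro V hV ⟨x, hxV, hx⟩ hh
    obtain ⟨_, ⟨n, rfl⟩, hxn, hn⟩ := hB.exists_subset_of_mem_open hxV hV
    refine hx (mem_iUnion.2 ⟨⟨n, ?_⟩, hxn⟩)
    refine ((hh.coveredBy one_lt_aleph0.le).union le_rfl hOc).mono fun y hy => ?_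
    by_cases hyO : y ∈ O
    · exact Or.inr hyO
    · exact Or.inl ⟨hn hy, hyO⟩

theorem exists_color_eq {X : Type u} {c : PairColoring X} {S : Set X}
    (h : ¬ c.IsHomogeneous S) (i : Fin 2) :
    ∃ x ∈ S, ∃ y ∈ S, ∃ h : x ≠ y, c (Pairs.mk x y h) = i := by
  by_contra! hcon
  refine h ⟨1 - i, fun x hx y hy hxy => ?_⟩
  have := hcon x hx y hy hxy
  omega

theorem exists_isOpen_closure_subset {X : Type u} [MetricSpace X] {U : Set X} (hU : IsOpen U)
    {x : X} (hx : x ∈ U) (n : ℕ) : ∃ W : Set X, IsOpen W ∧ x ∈ W ∧ closure W ⊆ U ∧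
      Metric.ediam W ≤ ((n + 1 : ℕ) : ENNReal)⁻¹ := by
  have hpos : (0 : ENNReal) < ((n + 1 : ℕ) : ENNReal)⁻¹ / 2 :=
    ENNReal.half_pos (ENNReal.inv_ne_zero.2 (ENNReal.natCast_ne_top _))
  obtain ⟨r, hr, hrU⟩ := Metric.nhds_basis_closedEBall.mem_iff.1 (hU.mem_nhds hx)
  refine ⟨Metric.eball x (min r (((n + 1 : ℕ) : ENNReal)⁻¹ / 2)), Metric.isOpen_eball,
    Metric.mem_eball_self (lt_min hr hpos), ?_, ?_⟩
  · refine (closure_minimal Metric.eball_subset_closedEBall Metric.isClosed_closedEBall).trans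
      ((Metric.closedEBall_subset_closedEBall (min_le_left _ _)).trans hrU)
  · refine Metric.ediam_eball_le.trans ?_
    refine (mul_le_mul_right (min_le_right _ _) _).trans ?_
    rw [ENNReal.mul_div_cancel two_ne_zero ENNReal.ofNat_ne_top]

/-- At depth `n` the kernel supplies a pair of color `n % 2` in the current open set; by continuity,
small neighborhoods of its two points keep that color and become the two children. Shrinking
closures and completeness give a point on each branch. -/
theorem exists_embeds_cMin {X : Type u} [TopologicalSpace X] [PolishSpace X]
    {c : PairColoring X} (hc : c.IsContinuous) (h : ℵ₀ < c.hm) :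
    ∃ e : (ℕ → Fin 2) → X, cMin.Embeds c univ e := by
  let := TopologicalSpace.upgradeIsCompletelyMetrizable X
  obtain ⟨Y, hY, hYh⟩ := exists_kernel h
  have step : ∀ (n : ℕ) (U : {U : Set X // IsOpen U ∧ (U ∩ Y).Nonempty}),
      ∃ V : Fin 2 → {U : Set X // IsOpen U ∧ (U ∩ Y).Nonempty},
        (∀ a, closure (V a).1 ⊆ U.1 ∧ Metric.ediam (V a).1 ≤ ((n + 1 : ℕ) : ENNReal)⁻¹) ∧
        ∀ x ∈ (V 0).1, ∀ y ∈ (V 1).1, ∃ h : x ≠ y, (c (Pairs.mk x y h)).val = n % 2 := by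
    rintro n ⟨U, hU, hne⟩
    obtain ⟨x, hx, y, hy, hxy, hcol⟩ := exists_color_eq (hYh U hU hne) ⟨n % 2, by omega⟩
    obtain ⟨N, N', hN, hN', hxN, hyN', hNN⟩ := hc.exists_isOpen hxy
    obtain ⟨W, hW, hxW, hWU, hWd⟩ :=
      exists_isOpen_closure_subset (hU.inter hN) ⟨hx.1, hxN⟩ n
    obtain ⟨W', hW', hyW', hWU', hWd'⟩ :=
      exists_isOpen_closure_subset (hU.inter hN') ⟨hy.1, hyN'⟩ n
    refine ⟨![⟨W, hW, x, hxW, hx.2⟩, ⟨W', hW', y, hyW', hy.2⟩], ?_, ?_⟩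
    · rw [Fin.forall_fin_two]
      exact ⟨⟨hWU.trans inter_subset_left, hWd⟩, ⟨hWU'.trans inter_subset_left, hWd'⟩⟩
    · intro a ha b hb
      obtain ⟨h', hab⟩ := hNN a (hWU (subset_closure ha)).2 b (hWU' (subset_closure hb)).2
      exact ⟨h', by rw [hab, hcol]⟩
  choose V hV hVc using step
  let A : List (Fin 2) → {U : Set X // IsOpen U ∧ (U ∩ Y).Nonempty} := fun l =>
    List.rec ⟨univ, isOpen_univ, by simpa using hY⟩ (fun a l U => V l.length U a) l
  have hA : ∀ a l, A (a :: l) = V l.length (A l) a := fun _ _ => rfl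
  have hanti : CantorScheme.ClosureAntitone fun l => (A l).1 := fun l a => (hV _ _ a).1
  have hdiam : CantorScheme.VanishingDiam fun l => (A l).1 := by
    intro x
    rw [← tendsto_add_atTop_iff_nat 1]
    refine tendsto_of_tendsto_of_tendsto_of_le_of_le tendsto_const_nhds
      ((tendsto_add_atTop_iff_nat 1).2 ENNReal.tendsto_inv_nat_nhds_zero)
      (fun _ => zero_le) fun n => ?_
    have := (hV (PiNat.res x n).length (A (PiNat.res x n)) (x n)).2
    rw [PiNat.res_length] at this
    simpa only [PiNat.res_succ, hA, PiNat.res_length] using this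
  have huniv := hanti.map_of_vanishingDiam hdiam fun l => (A l).2.2.left
  let e : (ℕ → Fin 2) → X := fun x =>
    (CantorScheme.inducedMap fun l => (A l).1).2 ⟨x, huniv ▸ mem_univ x⟩
  have he : ∀ x n, e x ∈ (A (PiNat.res x n)).1 := fun x n => CantorScheme.map_mem _ n
  have key : ∀ x y, ∀ h : x ≠ y, x (PiNat.firstDiff x y) = 0 → y (PiNat.firstDiff x y) = 1 →
      ∃ h' : e x ≠ e y, c (Pairs.mk (e x) (e y) h') = cMin (Pairs.mk x y h) := by
    intro x y hxy h0 h1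
    set n := PiNat.firstDiff x y with hn
    have hres : PiNat.res x n = PiNat.res y n :=
      PiNat.res_eq_res.2 fun j hj => PiNat.apply_eq_of_lt_firstDiff hj
    have hx := he x (n + 1)
    have hy := he y (n + 1)
    rw [PiNat.res_succ, hA, h0] at hx
    rw [PiNat.res_succ, hA, h1, ← hres] at hy
    obtain ⟨h', hcol⟩ := hVc _ _ _ hx _ hy
    refine ⟨h', Fin.ext ?_⟩
    rw [hcol, PiNat.res_length, cMin_mk]
  refine ⟨e, fun x _ y _ hxy => ?_⟩
  have hne := PiNat.apply_firstDiff_ne hxy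
  by_cases h0 : x (PiNat.firstDiff x y) = 0
  · exact key x y hxy h0 (by omega)
  · obtain ⟨h', hcol⟩ := key y x hxy.symm (by rw [PiNat.firstDiff_comm]; omega)
      (by rw [PiNat.firstDiff_comm]; omega)
    exact ⟨h'.symm, by rw [Pairs.mk_comm, hcol, Pairs.mk_comm]⟩

end PairColoring

/-! ### Compact pieces and embeddings into `c_max` -/

namespace PairColoring

theorem cMax_mk (R : SimpleGraph ℕ) {x y : (n : ℕ) → Fin (n + 1)} (h : x ≠ y) :
    cMax R (Pairs.mk x y h) = 1 ↔
      R.Adj (x (PiNat.firstDiff x y)).val (y (PiNat.firstDiff x y)).val := by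
  classical
  change (if R.Adj (x (PiNat.firstDiff x y)).val (y (PiNat.firstDiff x y)).val
    then (1 : Fin 2) else 0) = 1 ↔ _
  split_ifs with hR <;> simp [hR]

theorem exists_strictMono_ge (M : ℕ → ℕ) : ∃ m : ℕ → ℕ, StrictMono m ∧ ∀ k, M k ≤ m k := by
  refine ⟨fun k => k + ∑ l ∈ Finset.range (k + 1), M l, strictMono_nat_of_lt_succ fun k => ?_,
    fun k => ?_⟩
  · simp only [Finset.sum_range_succ _ (k + 1)]
    omega
  · simp only [Finset.sum_range_succ]
    omega

/-- By `hdet`, the two code values at the first difference decide the color, so color 1 is adjacency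
in a graph on code values, and this graph embeds into `R`. Boundedness lets coordinate `k` be moved
to a later coordinate `m k` with room for all its values. -/
theorem coveredBy_hm_cMax {X : Type u} {c : PairColoring X} {S : Set X} {R : SimpleGraph ℕ}
    (hR : ∀ G : SimpleGraph ℕ, Nonempty (G ↪g R)) {ψ : X → ℕ → ℕ} (hinj : InjOn ψ S)
    (hbdd : ∀ k, ∃ b, ∀ x ∈ S, ψ x k ≤ b)
    (hdet : ∀ x ∈ S, ∀ y ∈ S, ∀ x' ∈ S, ∀ y' ∈ S, ∀ (h : x ≠ y) (h' : x' ≠ y'),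
      ψ x (PiNat.firstDiff (ψ x) (ψ y)) = ψ x' (PiNat.firstDiff (ψ x') (ψ y')) →
      ψ y (PiNat.firstDiff (ψ x) (ψ y)) = ψ y' (PiNat.firstDiff (ψ x') (ψ y')) →
      c (Pairs.mk x y h) = c (Pairs.mk x' y' h')) :
    c.CoveredBy S (cMax R).hm := by
  let G : SimpleGraph ℕ :=
    { Adj := fun u v => ∃ x ∈ S, ∃ y ∈ S, ∃ h : x ≠ y,
        ψ x (PiNat.firstDiff (ψ x) (ψ y)) = u ∧ ψ y (PiNat.firstDiff (ψ x) (ψ y)) = v ∧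
          c (Pairs.mk x y h) = 1
      symm := ⟨by
        rintro u v ⟨x, hx, y, hy, h, hu, hv, hc⟩
        refine ⟨y, hy, x, hx, h.symm, ?_, ?_, ?_⟩
        · rwa [PiNat.firstDiff_comm]
        · rwa [PiNat.firstDiff_comm]
        · rwa [Pairs.mk_comm]⟩
      loopless := ⟨by
        rintro u ⟨x, hx, y, hy, h, hu, hv, -⟩
        exact PiNat.apply_firstDiff_ne (hinj.ne hx hy h) (hu.trans hv.symm)⟩ }
  obtain ⟨j⟩ := hR G
  have hM : ∀ k, ∃ M, ∀ x ∈ S, j (ψ x k) ≤ M := by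
    intro k
    obtain ⟨b, hb⟩ := hbdd k
    exact ⟨(Finset.range (b + 1)).sup j, fun x hx =>
      Finset.le_sup (f := j) (Finset.mem_range.2 (Nat.lt_succ_of_le (hb x hx)))⟩
  choose M hM using hM
  obtain ⟨m, hm, hMm⟩ := exists_strictMono_ge M
  classical
  -- The filler 0 off the range of `m` creates no new differences, so a first difference `k` becomes
  -- exactly `m k`.
  let e : X → (n : ℕ) → Fin (n + 1) := fun x n =>
    if n ∈ range m then Fin.ofNat (n + 1) (j (ψ x (Function.invFun m n))) else 0
  have he : ∀ x ∈ S, ∀ k, (e x (m k)).val = j (ψ x k) := by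
    intro x hx k
    have h1 : Function.invFun m (m k) = k := Function.leftInverse_invFun hm.injective k
    have h2 : j (ψ x k) % (m k + 1) = j (ψ x k) :=
      Nat.mod_eq_of_lt (Nat.lt_succ_of_le ((hM k x hx).trans (hMm k)))
    simp [e, h1, h2]
  refine Embeds.coveredBy (d := cMax R) (e := e) ?_ (coveredBy_univ_hm _)
  intro x hx y hy h
  have hψ := PiNat.apply_firstDiff_ne (hinj.ne hx hy h)
  set k := PiNat.firstDiff (ψ x) (ψ y) with hk
  have hne : e x (m k) ≠ e y (m k) := by
    rw [Ne, Fin.ext_iff, he x hx, he y hy]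
    exact fun h => hψ (j.injective h)
  have hfd : PiNat.firstDiff (e x) (e y) = m k := by
    refine firstDiff_eq_of_forall_lt (fun i hi => ?_) hne
    by_cases hr : i ∈ range m
    · obtain ⟨l, rfl⟩ := hr
      refine Fin.ext ?_
      rw [he x hx, he y hy, PiNat.apply_eq_of_lt_firstDiff (x := ψ x) (y := ψ y)
        (hk ▸ hm.lt_iff_lt.1 hi)]
    · simp only [e, if_neg hr]
  refine ⟨fun h => hne (congrFun h _), ?_⟩
  have hiff : cMax R (Pairs.mk (e x) (e y) fun h => hne (congrFun h _)) = 1 ↔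
      c (Pairs.mk x y h) = 1 := by
    rw [cMax_mk, hfd, he x hx, he y hy, j.map_adj_iff]
    constructor
    · rintro ⟨x', hx', y', hy', h', hu, hv, hc⟩
      rw [← hc]
      exact hdet x hx y hy x' hx' y' hy' h h' hu.symm hv.symm
    · intro hc
      exact ⟨x, hx, y, hy, h, rfl, rfl, hc⟩
  omega

/-- Pairing each digit with its index makes the level, hence its parity, readable from the code
value. -/
theorem hm_cMin_le_hm_cMax {R : SimpleGraph ℕ} (hR : ∀ G : SimpleGraph ℕ, Nonempty (G ↪g R)) :
    cMin.hm ≤ (cMax R).hm := by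
  have hfd : ∀ x y : ℕ → Fin 2, x ≠ y → PiNat.firstDiff (fun k => Nat.pair k (x k).val)
      (fun k => Nat.pair k (y k).val) = PiNat.firstDiff x y := by
    intro x y h
    refine firstDiff_eq_of_forall_lt (fun j hj => ?_) ?_
    · rw [PiNat.apply_eq_of_lt_firstDiff hj]
    · have := PiNat.apply_firstDiff_ne h
      simpa [Fin.ext_iff] using this
  have : cMin.CoveredBy univ (cMax R).hm := by
    refine coveredBy_hm_cMax hR (ψ := fun x k => Nat.pair k (x k).val) ?_ ?_ ?_
    · intro x _ y _ h
      funext k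
      simpa [Fin.ext_iff] using congrFun h k
    · intro k
      refine ⟨max (Nat.pair k 0) (Nat.pair k 1), fun x _ => ?_⟩
      have : (x k).val = 0 ∨ (x k).val = 1 := by omega
      rcases this with h | h <;> simp [h]
    · intro x _ y _ x' _ y' _ h h' h1 h2
      rw [hfd x y h, hfd x' y' h'] at h1
      refine Fin.ext ?_
      rw [cMin_mk, cMin_mk, (Nat.pair_eq_pair.1 h1).1]
  simpa using this.hm_le

variable {X : Type u} [TopologicalSpace X] [T2Space X]

theorem eventually_mem_iff {B : ℕ → Set X} {K : Set X} (hB : ∀ n, IsOpen (B n))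
    (hKB : ∀ n, IsCompact (K ∩ B n)) (x : X) (m : ℕ) :
    ∀ᶠ x' in 𝓝[K] x, x' ∈ K ∧ ∀ j < m, (x' ∈ B j ↔ x ∈ B j) := by
  refine eventually_mem_nhdsWithin.and ?_
  have : ∀ᶠ x' in 𝓝[K] x, ∀ j ∈ Finset.range m, (x' ∈ B j ↔ x ∈ B j) := by
    rw [eventually_all_finset]
    intro j _
    by_cases hx : x ∈ B j
    · filter_upwards [mem_nhdsWithin_of_mem_nhds ((hB j).mem_nhds hx)] with x' hx'
      simp [hx, hx']
    · have h1 : (K ∩ B j)ᶜ ∈ 𝓝 x := (hKB j).isClosed.isOpen_compl.mem_nhds fun h => hx h.2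
      filter_upwards [mem_nhdsWithin_of_mem_nhds h1, self_mem_nhdsWithin] with x' hx' hK
      simp only [hx, iff_false]
      exact fun h => hx' ⟨hK, h⟩
  simpa using this

/-- Each pair has a neighborhood, described by finitely many basic sets, on which the color is
constant. The `B j` are relatively clopen in `K`, so traces are locally constant there, and
compactness of the product makes the number of sets uniform. -/
theorem IsContinuous.exists_agree_bound {c : PairColoring X} (hc : c.IsContinuous)
    {B : ℕ → Set X} {K : Set X} (hbasis : TopologicalSpace.IsTopologicalBasis (range B))
    (hKB : ∀ n, IsCompact (K ∩ B n)) (hKB' : ∀ n, IsCompact (K \ B n)) (n : ℕ) :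
    ∃ m, ∀ p ∈ (K ∩ B n) ×ˢ (K \ B n), ∀ q ∈ (K ∩ B n) ×ˢ (K \ B n),
      (∀ j < m, (q.1 ∈ B j ↔ p.1 ∈ B j) ∧ (q.2 ∈ B j ↔ p.2 ∈ B j)) →
      ∀ (h : p.1 ≠ p.2) (h' : q.1 ≠ q.2),
        c (Pairs.mk p.1 p.2 h) = c (Pairs.mk q.1 q.2 h') := by
  have hB : ∀ n, IsOpen (B n) := fun n => hbasis.isOpen ⟨n, rfl⟩
  refine IsCompact.induction_on (p := fun s => ∃ m, ∀ p ∈ s, ∀ q ∈ (K ∩ B n) ×ˢ (K \ B n),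
      (∀ j < m, (q.1 ∈ B j ↔ p.1 ∈ B j) ∧ (q.2 ∈ B j ↔ p.2 ∈ B j)) →
      ∀ (h : p.1 ≠ p.2) (h' : q.1 ≠ q.2),
        c (Pairs.mk p.1 p.2 h) = c (Pairs.mk q.1 q.2 h')) ((hKB n).prod (hKB' n)) ?_ ?_ ?_ ?_
  · exact ⟨0, by simp⟩
  · rintro s t hst ⟨m, hm⟩
    exact ⟨m, fun p hp => hm p (hst hp)⟩
  · rintro s t ⟨m, hm⟩ ⟨m', hm'⟩
    refine ⟨max m m', fun p hp q hq hj => ?_⟩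
    rcases hp with hp | hp
    · exact hm p hp q hq fun j hjm => hj j (lt_max_of_lt_left hjm)
    · exact hm' p hp q hq fun j hjm => hj j (lt_max_of_lt_right hjm)
  · rintro ⟨x, y⟩ ⟨hx, hy⟩
    have hxy : x ≠ y := fun h => hy.2 (h ▸ hx.2)
    obtain ⟨N, N', hN, hN', hxN, hyN', hNN⟩ := hc.exists_isOpen hxy
    obtain ⟨_, ⟨a, rfl⟩, hxa, ha⟩ := hbasis.exists_subset_of_mem_open hxN hN
    obtain ⟨_, ⟨b, rfl⟩, hyb, hb⟩ := hbasis.exists_subset_of_mem_open hyN' hN'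
    set m := max a b + 1 with hm
    have h1 : ∀ᶠ x' in 𝓝[K ∩ B n] x, x' ∈ K ∧ ∀ j < m, (x' ∈ B j ↔ x ∈ B j) :=
      (eventually_mem_iff hB hKB x m).filter_mono (nhdsWithin_mono _ inter_subset_left)
    have h2 : ∀ᶠ y' in 𝓝[K \ B n] y, y' ∈ K ∧ ∀ j < m, (y' ∈ B j ↔ y ∈ B j) :=
      (eventually_mem_iff hB hKB y m).filter_mono (nhdsWithin_mono _ sdiff_subset)
    refine ⟨_, by rw [nhdsWithin_prod_eq]; exact h1.prod_mk h2, m, ?_⟩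
    rintro ⟨x₁, y₁⟩ ⟨⟨-, hx₁⟩, -, hy₁⟩ ⟨x₂, y₂⟩ - hj h h'
    have hax : ∀ j < m, (x₂ ∈ B j ↔ x ∈ B j) := fun j hjm => (hj j hjm).1.trans (hx₁ j hjm)
    have hby : ∀ j < m, (y₂ ∈ B j ↔ y ∈ B j) := fun j hjm => (hj j hjm).2.trans (hy₁ j hjm)
    have ham : a < m := by omega
    have hbm : b < m := by omega
    obtain ⟨_, e1⟩ := hNN x₁ (ha ((hx₁ a ham).2 hxa)) y₁ (hb ((hy₁ b hbm).2 hyb))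
    obtain ⟨_, e2⟩ := hNN x₂ (ha ((hax a ham).2 hxa)) y₂ (hb ((hby b hbm).2 hyb))
    exact e1.trans e2.symm

theorem IsContinuous.exists_agree_bound_symm {c : PairColoring X} (hc : c.IsContinuous)
    {B : ℕ → Set X} {K : Set X} (hbasis : TopologicalSpace.IsTopologicalBasis (range B))
    (hKB : ∀ n, IsCompact (K ∩ B n)) (hKB' : ∀ n, IsCompact (K \ B n)) (n : ℕ) :
    ∃ m, ∀ x ∈ K, ∀ y ∈ K, ∀ x' ∈ K, ∀ y' ∈ K, ¬ (x ∈ B n ↔ y ∈ B n) →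
      (x ∈ B n ↔ x' ∈ B n) → (y ∈ B n ↔ y' ∈ B n) →
      (∀ j < m, (x ∈ B j ↔ x' ∈ B j)) → (∀ j < m, (y ∈ B j ↔ y' ∈ B j)) →
      ∀ (h : x ≠ y) (h' : x' ≠ y'), c (Pairs.mk x y h) = c (Pairs.mk x' y' h') := by
  obtain ⟨m, hm⟩ := hc.exists_agree_bound hbasis hKB hKB' n
  refine ⟨m, fun x hx y hy x' hx' y' hy' hxy hxx hyy hjx hjy h h' => ?_⟩
  by_cases hxn : x ∈ B n
  · have hyn : y ∉ B n := fun hyn => hxy (by simp [hxn, hyn])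
    exact hm (x, y) ⟨⟨hx, hxn⟩, hy, hyn⟩ (x', y') ⟨⟨hx', hxx.1 hxn⟩, hy', fun h => hyn (hyy.2 h)⟩
      (fun j hj => ⟨(hjx j hj).symm, (hjy j hj).symm⟩) h h'
  · have hyn : y ∈ B n := by_contra fun hyn => hxy (by simp [hxn, hyn])
    rw [Pairs.mk_comm h, Pairs.mk_comm h']
    exact hm (y, x) ⟨⟨hy, hyn⟩, hx, hxn⟩ (y', x') ⟨⟨hy', hyy.1 hyn⟩, hx', fun h => hxn (hxx.2 h)⟩
      (fun j hj => ⟨(hjy j hj).symm, (hjx j hj).symm⟩) h.symm h'.symm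

/-- Levels growing fast enough that `f j` is at most the next level after `j`. -/
def levels (f : ℕ → ℕ) : ℕ → ℕ
  | 0 => 0
  | k + 1 => levels f k + 1 + ∑ j ∈ Finset.range (levels f k), f j

theorem levels_strictMono (f : ℕ → ℕ) : StrictMono (levels f) :=
  strictMono_nat_of_lt_succ fun k => by
    simp only [levels]
    omega

theorem le_levels_succ (f : ℕ → ℕ) {j k : ℕ} (h : j < levels f k) : f j ≤ levels f (k + 1) := by
  have := Finset.single_le_sum (f := f) (fun i _ => Nat.zero_le _) (Finset.mem_range.2 h)
  simp only [levels]
  omega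

open Classical in
/-- The code of a level `k` and of the trace of `x` on the first `L (k + 1)` sets. -/
noncomputable def traceCode {X : Type u} (B : ℕ → Set X) (L : ℕ → ℕ) (x : X) (k : ℕ) : ℕ :=
  Nat.pair k (Encodable.encode ((Finset.range (L (k + 1))).filter fun j => x ∈ B j))

theorem traceCode_eq_iff {X : Type u} {B : ℕ → Set X} {L : ℕ → ℕ} {x y : X} {k l : ℕ} :
    traceCode B L x k = traceCode B L y l ↔
      k = l ∧ ∀ j < L (k + 1), (x ∈ B j ↔ y ∈ B j) := by
  classical
  rw [traceCode, traceCode, Nat.pair_eq_pair, Encodable.encode_inj]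
  refine and_congr_right ?_
  rintro rfl
  simp [Finset.ext_iff]

theorem traceCode_bounded {X : Type u} (B : ℕ → Set X) (L : ℕ → ℕ) (k : ℕ) :
    ∃ b, ∀ x, traceCode B L x k ≤ b := by
  classical
  refine ⟨(Finset.range (L (k + 1))).powerset.sup fun s => Nat.pair k (Encodable.encode s),
    fun x => ?_⟩
  exact Finset.le_sup (f := fun s : Finset ℕ => Nat.pair k (Encodable.encode s))
    (Finset.mem_powerset.2 (Finset.filter_subset _ _))

/-- A pair with first code difference `k` is separated by some `B j` with `j < L (k + 1)`, so its
color depends on traces below `f j ≤ L (k + 2)`, one level more than code `k` records. On a set of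
constant parity this level is free: two points agreeing at a level `k` of that parity cannot first
differ at `k + 1`, so code `k` determines code `k + 1`. -/
theorem IsContinuous.coveredBy_of_compact {c : PairColoring X} (hc : c.IsContinuous)
    {R : SimpleGraph ℕ} (hR : ∀ G : SimpleGraph ℕ, Nonempty (G ↪g R))
    {B : ℕ → Set X} {K : Set X} (hbasis : TopologicalSpace.IsTopologicalBasis (range B))
    (hKB : ∀ n, IsCompact (K ∩ B n)) (hKB' : ∀ n, IsCompact (K \ B n)) :
    c.CoveredBy K (cMax R).hm := by
  choose f hf using hc.exists_agree_bound_symm hbasis hKB hKB'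
  set L := levels f with hL
  have hLm : StrictMono L := levels_strictMono f
  obtain ⟨ι, H, i, hι, hH, hU⟩ := exists_parity_cover
  have hcov : K ⊆ ⋃ a, K ∩ traceCode B L ⁻¹' H a := fun x hx => by
    obtain ⟨a, ha⟩ := hU (traceCode B L x)
    exact mem_iUnion.2 ⟨a, hx, ha⟩
  have hle := hm_cMin_le_hm_cMax hR
  refine CoveredBy.mono (CoveredBy.iUnion (aleph0_le_hm_cMin.trans hle) (hι.trans hle)
    fun a => ?_) hcov
  have hinj : Function.Injective (traceCode B L) := by
    intro x y h
    by_contra hxy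
    obtain ⟨_, ⟨j, rfl⟩, hxj, hj⟩ :=
      hbasis.exists_subset_of_mem_open (show x ∈ ({y}ᶜ : Set X) from hxy) isOpen_compl_singleton
    have := (traceCode_eq_iff.1 (congrFun h j)).2 j (Nat.lt_of_succ_le (hLm.le_apply))
    exact hj (this.1 hxj) rfl
  have hnext : ∀ x ∈ traceCode B L ⁻¹' H a, ∀ x' ∈ traceCode B L ⁻¹' H a, ∀ k,
      k % 2 = (i a).val → traceCode B L x k = traceCode B L x' k →
      ∀ j < L (k + 1 + 1), (x ∈ B j ↔ x' ∈ B j) := by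
    intro x hx x' hx' k hk hxx
    suffices h : traceCode B L x (k + 1) = traceCode B L x' (k + 1) from (traceCode_eq_iff.1 h).2
    by_contra hne
    have hfd : PiNat.firstDiff (traceCode B L x) (traceCode B L x') = k + 1 := by
      refine firstDiff_eq_of_forall_lt (fun l hl => ?_) hne
      refine traceCode_eq_iff.2 ⟨rfl, fun j hj => (traceCode_eq_iff.1 hxx).2 j ?_⟩
      exact hj.trans_le (hLm.monotone (by omega))
    have := hH a _ hx _ hx' fun h => hne (congrFun h _)
    omega
  refine coveredBy_hm_cMax hR hinj.injOn (fun k => ?_) ?_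
  · obtain ⟨b, hb⟩ := traceCode_bounded B L k
    exact ⟨b, fun x _ => hb x⟩
  · rintro x ⟨hxK, hx⟩ y ⟨hyK, hy⟩ x' ⟨hxK', hx'⟩ y' ⟨hyK', hy'⟩ h h' hxx hyy
    have hk := hH a _ hx _ hy (hinj.ne h)
    have hne := PiNat.apply_firstDiff_ne (hinj.ne h)
    obtain ⟨hkk, hax⟩ := traceCode_eq_iff.1 hxx
    obtain ⟨-, hay⟩ := traceCode_eq_iff.1 hyy
    rw [← hkk] at hxx hyy
    set k := PiNat.firstDiff (traceCode B L x) (traceCode B L y)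
    have hex : ∃ j < L (k + 1), ¬ (x ∈ B j ↔ y ∈ B j) := by
      by_contra! hcon
      exact hne (traceCode_eq_iff.2 ⟨rfl, hcon⟩)
    obtain ⟨j, hj, hsep⟩ := hex
    have hfj := le_levels_succ f hj
    exact hf j x hxK y hyK x' hxK' y' hyK' hsep (hax j hj) (hay j hj)
      (fun l hl => hnext x hx x' hx' k hk hxx l (hl.trans_le hfj))
      (fun l hl => hnext y hy y' hy' k hk hyy l (hl.trans_le hfj)) h h'

end PairColoring

/-! ### From compact pieces to Polish spaces, and the dichotomy -/

theorem exists_dominating : ∃ D : Set (ℕ → ℕ),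
    (∀ g : ℕ → ℕ, ∃ f ∈ D, ∀ᶠ n in atTop, g n ≤ f n) ∧ #D = dominationNumber :=
  csInf_mem (s := {κ : Cardinal.{0} | ∃ D : Set (ℕ → ℕ),
    (∀ g : ℕ → ℕ, ∃ f ∈ D, ∀ᶠ n in atTop, g n ≤ f n) ∧ #D = κ})
    ⟨_, univ, fun g => ⟨g, mem_univ _, by simp⟩, rfl⟩

theorem exists_polishSpace_isClopen {X : Type u} [t : TopologicalSpace X] [PolishSpace X]
    {B : ℕ → Set X} (hB : ∀ n, IsOpen (B n)) :
    ∃ t' : TopologicalSpace X, t' ≤ t ∧ @PolishSpace X t' ∧ ∀ n, @IsClopen X t' (B n) := by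
  choose m hm hp hcl hop using fun n => (hB n).isClopenable
  obtain ⟨t', ht', hle, hp'⟩ := PolishSpace.exists_polishSpace_forall_le m hm hp
  exact ⟨t', hle, hp', fun n => ⟨⟨ht' n _ (hcl n).isOpen_compl⟩, ht' n _ (hop n)⟩⟩

theorem exists_le_max_of_eventually_le {g f : ℕ → ℕ} (h : ∀ᶠ n in atTop, g n ≤ f n) :
    ∃ m, ∀ n, g n ≤ max (f n) m := by
  obtain ⟨N, hN⟩ := eventually_atTop.1 h
  refine ⟨(Finset.range N).sup g, fun n => ?_⟩
  rcases lt_or_ge n N with hn | hn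
  · exact le_max_of_le_right (Finset.le_sup (Finset.mem_range.2 hn))
  · exact le_max_of_le_left (hN n hn)

theorem isCompact_setOf_forall_le (b : ℕ → ℕ) : IsCompact {z : ℕ → ℕ | ∀ n, z n ≤ b n} := by
  have := isCompact_univ_pi fun n => (finite_Iic (b n)).isCompact
  convert this using 1
  ext z
  simp [Pi.le_def]

/-- Compact pieces are taken in a finer Polish topology where every `B n` is clopen, so their
intersections and differences with `B n` are compact there and hence in the original topology. They
are images of the compact boxes in Baire space bounded by `max (f n) m`, where `m` absorbs the
finitely many exceptions to domination by `f`. -/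
theorem PairColoring.IsContinuous.hm_le_hm_cMax {X : Type u} [t : TopologicalSpace X]
    [PolishSpace X] [Nonempty X] {c : PairColoring X} (hc : c.IsContinuous)
    {R : SimpleGraph ℕ} (hR : ∀ G : SimpleGraph ℕ, Nonempty (G ↪g R)) :
    c.hm ≤ lift.{u} (cMax R).hm := by
  obtain ⟨B, hbasis⟩ := exists_nat_isTopologicalBasis X
  have hpiece : ∀ K : Set X, (∀ n, IsCompact (K ∩ B n)) → (∀ n, IsCompact (K \ B n)) →
      c.CoveredBy K (cMax R).hm := fun K => hc.coveredBy_of_compact hR hbasis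
  obtain ⟨t', hle, hp', hcl⟩ := exists_polishSpace_isClopen fun n => hbasis.isOpen ⟨n, rfl⟩
  obtain ⟨g, hg, hsurj⟩ := @PolishSpace.exists_nat_nat_continuous_surjective X t' hp' _
  obtain ⟨D, hD, hDc⟩ := exists_dominating
  have hcmp : ∀ s, @IsCompact X t' s → @IsCompact X t s := fun s hs => by
    have := @IsCompact.image X X t' t s id hs (continuous_id_of_le hle)
    rwa [image_id] at this
  have hle' := hm_cMin_le_hm_cMax hR
  have hinf := aleph0_le_hm_cMin.trans hle'
  let K : D × ℕ → Set X := fun p => g '' {z | ∀ n, z n ≤ max (p.1.1 n) p.2}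
  have hK : ∀ p, @IsCompact X t' (K p) := fun p =>
    @IsCompact.image _ _ _ t' _ _ (isCompact_setOf_forall_le _) hg
  refine CoveredBy.hm_le (CoveredBy.mono (CoveredBy.iUnion (ι := D × ℕ) (S := K) hinf ?_
    fun p => hpiece (K p) ?_ ?_) ?_)
  · rw [mk_prod, lift_id, lift_id, hDc, mk_nat]
    exact mul_le_of_le hinf (dominationNumber_le_hm_cMin.trans hle') hinf
  · exact fun n => hcmp _ (@IsCompact.inter_right X t' _ _ (hK p) (hcl n).1)
  · exact fun n => hcmp _ (@IsCompact.diff X t' _ _ (hK p) (hcl n).2)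
  · intro x _
    obtain ⟨z, rfl⟩ := hsurj x
    obtain ⟨f, hf, hfz⟩ := hD z
    obtain ⟨m, hm⟩ := exists_le_max_of_eventually_le hfz
    exact mem_iUnion.2 ⟨(⟨f, hf⟩, m), z, hm, rfl⟩

theorem PairColoring.hm_cMax_le (R : SimpleGraph ℕ) : (cMax R).hm ≤ 2 ^ ℵ₀ := by
  have h : (cMax R).CoveredBy univ (2 ^ ℵ₀) := by
    refine ⟨(n : ℕ) → Fin (n + 1), fun x => {x}, ?_, fun x => ⟨0, ?_⟩, fun x _ => by simp⟩
    · have : Function.Injective fun (x : (n : ℕ) → Fin (n + 1)) (n : ℕ) => (x n).val :=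
        fun x y h => funext fun n => Fin.ext (congrFun h n)
      simpa using mk_le_of_injective this
    · rintro a rfl b rfl h
      exact absurd rfl h
  simpa using h.hm_le

theorem mainTheorem1 :
    (∀ (R : SimpleGraph ℕ), IsRandomGraph R →
      ∀ (X : Type u) [TopologicalSpace X] [PolishSpace X] (c : PairColoring X),
        c.IsContinuous → Cardinal.aleph0 < c.hm →
          (Cardinal.lift.{u} PairColoring.cMin.hm ≤ c.hm ∧ c.hm ≤ Cardinal.lift.{u} (PairColoring.cMax R).hm) ∧
          (c.hm = Cardinal.lift.{u} PairColoring.cMin.hm ∨ c.hm = Cardinal.lift.{u} (PairColoring.cMax R).hm)) ∧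
    2 ^ Cardinal.aleph0.{0} ≤ Order.succ PairColoring.cMin.hm ∧
    dominationNumber ≤ PairColoring.cMin.hm := by
  refine ⟨?_, PairColoring.continuum_le_succ_hm_cMin, PairColoring.dominationNumber_le_hm_cMin⟩
  intro R hR X _ _ c hc h
  have hX : Nonempty X := by
    obtain ⟨Y, ⟨x, -⟩, -⟩ := PairColoring.exists_kernel h
    exact ⟨x⟩
  obtain ⟨e, he⟩ := PairColoring.exists_embeds_cMin hc h
  have hmin := he.lift_hm_le
  have hmax := hc.hm_le_hm_cMax hR.universal
  refine ⟨⟨hmin, hmax⟩, ?_⟩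
  rcases hmin.eq_or_lt with heq | hlt
  · exact Or.inl heq.symm
  -- Above `cMin.hm` there is no room below the continuum, and `c_max` is covered by its continuum
  -- many singletons.
  · refine Or.inr (hmax.antisymm ?_)
    calc lift.{u} (PairColoring.cMax R).hm ≤ lift.{u} (Order.succ PairColoring.cMin.hm) :=
          lift_le.2 ((PairColoring.hm_cMax_le R).trans PairColoring.continuum_le_succ_hm_cMin)
      _ = Order.succ (lift.{u} PairColoring.cMin.hm) := lift_succ _
      _ ≤ c.hm := Order.succ_le_of_lt hlt
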